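/- Let $(\mathcal S,\mathcal A,\mathrm P,r,\gamma)$ be a Markov decision process with finite state set $\mathcal S$, finite action set $\mathcal A$, transition probabilities $\mathrm P(s,a,s')$ and transition-based discount $\gamma:\mathcal S\times\mathcal A\times\mathcal S\to[0,1]$. On a transition from $S_t$ to $S_{t+1}$ under $A_t$ the reward $R_{t+1}$ is drawn, independently of the past given $(S_t,A_t,S_{t+1})$, from a law that depends only on $(S_t,A_t,S_{t+1})$ and has finite mean $r(S_t,A_t,S_{t+1})$; put $\gamma_{t+1}=\gamma(S_t,A_t,S_{t+1})$. Let $\pi(\cdot,\cdot;\theta)$, $\theta\in\mathbb R^d$, be target policies, differentiable in $\theta$. Fix $\theta$ and write $\pi=\pi(\cdot,\cdot;\theta)$, $$v_\pi(s)=\mathbb E_\pi[G_0\mid S_0=s],\qquad q_\pi(s,a)=\mathbb E_\pi[G_0\mid S_0=s,A_0=a],\qquad G_0=R_1+\gamma_1R_2+\gamma_1\gamma_2R_3+\cdots,$$ $$\mathbf P_{\pi,\gamma}(s,s')=\sum_a\pi(s,a)\,\mathrm P(s,a,s')\,\gamma(s,a,s').$$ Let $\mu$ be a behaviour policy and suppose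 that (Yu, 2015) $\mathbf I-\mathbf P_{\pi,\gamma}$ is invertible, the Markov chain on $\mathcal S$ induced by $\mu$ is irreducible, and $\mu(s,a)=0$ implies $\pi(s,a)=0$. Let $S_0$ have some initial distribution (for example a fixed state $s_0$), let all actions be selected by $\mu$, and suppose that the limiting distribution $d_\mu(s)=\lim_{t\to\infty}\mathrm P(S_t=s)$ exists. Let $i:\mathcal S\to[0,\infty)$ and $\lambda_a\in[0,1]$, and put $$\rho_t=\frac{\pi(S_t,A_t)}{\mu(S_t,A_t)},\qquad \delta_t=R_{t+1}+\gamma_{t+1}v_\pi(S_{t+1})-v_\pi(S_t),$$ $$F_0=0,\qquad F_t=\gamma_t\rho_{t-1}F_{t-1}+i(S_t),\qquad M_t=(1-\lambda_a)\,i(S_t)+\lambda_aF_t .$$ With the vector $\mathbf i(s)=d_\mu(s)\,i(s)$ define $$\mathbf m_{\lambda_a}^\top=\mathbf i^\top(\mathbf I-\mathbf P_{\pi,\gamma})^{-1}\bigl(\mathbf I-(1-\lambda_a)\mathbf P_{\pi,\gamma}\bigr),\qquad \mathbf m^\top=\mathbf i^\top(\mathbf I-\mathbf P_{\pi,\gamma})^{-1}.$$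 Then, for every $\lambda_a\in[0,1]$, the update $\rho_tM_t\delta_t\nabla_\theta\ln\pi(S_t,A_t;\theta)$ is integrable for every $t$, and its steady-state expectation under $\mu$ is $$\lim_{t\to\infty}\mathbb E_\mu\bigl[\rho_tM_t\delta_t\nabla_\theta\ln\pi(S_t,A_t;\theta)\bigr]=\sum_s m_{\lambda_a}(s)\sum_a\frac{\partial\pi(s,a;\theta)}{\partial\theta}\,q_\pi(s,a).$$ In particular, for $\lambda_a=1$ it equals the off-policy gradient $\sum_s m(s)\sum_a\frac{\partial\pi(s,a;\theta)}{\partial\theta}\,q_\pi(s,a)$. -/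

import Mathlib

open MeasureTheory ProbabilityTheory Filter Topology

noncomputable section

namespace OffPolicy

/-- A finite Markov decision process with transition-based discounting. `P s a` is the law of the
next state, `rewardLaw s a s'` the law of the (random) reward emitted on the transition
`(s, a, s')`, assumed to have a finite mean, and `γ s a s'` the discount of that transition. -/
structure MDP (S A : Type*) where
  P : S → A → PMF S
  rewardLaw : S → A → S → Measure ℝ
  isProbabilityMeasure_rewardLaw : ∀ s a s', IsProbabilityMeasure (rewardLaw s a s')
  integrable_reward : ∀ s a s', Integrable (fun x : ℝ => x) (rewardLaw s a s')
  γ : S → A → S → ℝ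
  γ_nonneg : ∀ s a s', 0 ≤ γ s a s'
  γ_le_one : ∀ s a s', γ s a s' ≤ 1

/-- What is recorded at time `t`: the triple `(R_t, S_t, A_t)`. -/
abbrev Obs (S A : Type*) := ℝ × S × A

/-- Trajectories `(R_t, S_t, A_t)_{t ≥ 0}`; the coordinate `R_0` is a dummy. -/
abbrev Path (S A : Type*) := ℕ → Obs S A

section Processes

variable {S A : Type*}

/-- The state `S_t`. -/
def stateAt (t : ℕ) (ω : Path S A) : S := (ω t).2.1

/-- The action `A_t`. -/
def actionAt (t : ℕ) (ω : Path S A) : A := (ω t).2.2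

/-- The reward `R_t` (meaningful for `t ≥ 1`). -/
def rewardAt (t : ℕ) (ω : Path S A) : ℝ := (ω t).1

/-- The discount `γ_{t+1} = γ(S_t, A_t, S_{t+1})`; the index `t` here is that of the departure
state. -/
def MDP.discountAfter (M : MDP S A) (t : ℕ) (ω : Path S A) : ℝ :=
  M.γ (stateAt t ω) (actionAt t ω) (stateAt (t + 1) ω)

/-- The return `G_0 = R_1 + γ_1 R_2 + γ_1 γ_2 R_3 + ⋯`. -/
def MDP.discountedReturn (M : MDP S A) (ω : Path S A) : ℝ :=
  ∑' k : ℕ, (∏ j ∈ Finset.range k, M.discountAfter j ω) * rewardAt (k + 1) ω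

/-- The importance sampling ratio `ρ_t = π(S_t, A_t) / μ(S_t, A_t)`. -/
def ratioAt (π μ : S → PMF A) (t : ℕ) (ω : Path S A) : ℝ :=
  (π (stateAt t ω) (actionAt t ω)).toReal / (μ (stateAt t ω) (actionAt t ω)).toReal

/-- The follow-on trace: `F_0 = 0` and `F_{t+1} = γ_{t+1} ρ_t F_t + i(S_{t+1})`. -/
def MDP.followOn (M : MDP S A) (π μ : S → PMF A) (i : S → ℝ) : ℕ → Path S A → ℝ
  | 0, _ => 0
  | t + 1, ω => M.discountAfter t ω * ratioAt π μ t ω * M.followOn π μ i t ω + i (stateAt (t + 1) ω)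

/-- The emphasis `M_t = (1 - λ) i(S_t) + λ F_t`. -/
def MDP.emphasis (M : MDP S A) (π μ : S → PMF A) (i : S → ℝ) (lam : ℝ) (t : ℕ)
    (ω : Path S A) : ℝ :=
  (1 - lam) * i (stateAt t ω) + lam * M.followOn π μ i t ω

/-- The temporal difference error `δ_t = R_{t+1} + γ_{t+1} v(S_{t+1}) - v(S_t)`. -/
def MDP.tdError (M : MDP S A) (v : S → ℝ) (t : ℕ) (ω : Path S A) : ℝ :=
  rewardAt (t + 1) ω + M.discountAfter t ω * v (stateAt (t + 1) ω) - v (stateAt t ω)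

end Processes

section

variable {S A : Type*} [Fintype S] [Fintype A]

/-- The law of `(R_{t+1}, S_{t+1}, A_{t+1})` given `(S_t, A_t) = (s, a)` when actions are selected
by the policy `b`: the next state `s'` is drawn from `P s a`, the reward from `rewardLaw s a s'`,
the next action from `b s'`. -/
def MDP.stepLaw [MeasurableSpace S] [MeasurableSpace A] (M : MDP S A) (b : S → PMF A)
    (x : S × A) : Measure (Obs S A) :=
  ∑ s' : S, ∑ a' : A, (M.P x.1 x.2 s' * b s' a') •
    (M.rewardLaw x.1 x.2 s').map (fun r => ((r, s', a') : Obs S A))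

theorem pmf_sum_eq_one {B : Type*} [Fintype B] (p : PMF B) : ∑ b : B, p b = 1 := by
  rw [← tsum_fintype (L := .unconditional B)]
  exact p.tsum_coe

instance MDP.isProbabilityMeasure_stepLaw [MeasurableSpace S] [MeasurableSpace A] (M : MDP S A)
    (b : S → PMF A) (x : S × A) : IsProbabilityMeasure (M.stepLaw b x) := by
  constructor
  have h : ∀ s' a', ((M.rewardLaw x.1 x.2 s').map (fun r => ((r, s', a') : Obs S A)))
      Set.univ = 1 := by
    intro s' a'
    have := M.isProbabilityMeasure_rewardLaw x.1 x.2 s'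
    rw [Measure.map_apply (by fun_prop) MeasurableSet.univ]
    simp
  simp only [MDP.stepLaw, Measure.coe_finsetSum, Finset.sum_apply, Measure.smul_apply, h,
    smul_eq_mul, mul_one, ← Finset.mul_sum, pmf_sum_eq_one]

/-- The Markov kernel from the history up to time `n` to `(R_{n+1}, S_{n+1}, A_{n+1})`. -/
def MDP.stepKernel [MeasurableSpace S] [MeasurableSpace A] [MeasurableSingletonClass S]
    [MeasurableSingletonClass A] (M : MDP S A) (b : S → PMF A) (n : ℕ) :
    Kernel (Π _ : Finset.Iic n, Obs S A) (Obs S A) :=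
  Kernel.comap ⟨M.stepLaw b, measurable_of_finite _⟩
    (fun h => (h ⟨n, Finset.mem_Iic.2 le_rfl⟩).2) (by fun_prop)

instance MDP.isMarkovKernel_stepKernel [MeasurableSpace S] [MeasurableSpace A]
    [MeasurableSingletonClass S] [MeasurableSingletonClass A] (M : MDP S A) (b : S → PMF A)
    (n : ℕ) : IsMarkovKernel (M.stepKernel b n) :=
  ⟨fun h => M.isProbabilityMeasure_stepLaw b (h ⟨n, Finset.mem_Iic.2 le_rfl⟩).2⟩

/-- The law of `(R_0, S_0, A_0)` with `S_0` drawn from `ν`, `A_0` from `b S_0` and `R_0 = 0`. -/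
def startLaw [MeasurableSpace S] [MeasurableSpace A] (b : S → PMF A) (ν : PMF S) :
    Measure (Obs S A) :=
  ∑ s : S, ∑ a : A, (ν s * b s a) • Measure.dirac ((0, s, a) : Obs S A)

/-- The law of the whole trajectory when `S_0` is drawn from `ν` and all actions are selected
by the policy `b`. -/
def MDP.pathLaw [MeasurableSpace S] [MeasurableSpace A] [MeasurableSingletonClass S]
    [MeasurableSingletonClass A] (M : MDP S A) (b : S → PMF A) (ν : PMF S) :
    Measure (Path S A) :=
  Kernel.trajMeasure (X := fun _ => Obs S A) (startLaw b ν) (M.stepKernel b)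

/-- The law of the whole trajectory when `(S_0, A_0) = (s, a)` and all later actions are selected
by the policy `b`. -/
def MDP.pathLawFrom [MeasurableSpace S] [MeasurableSpace A] [MeasurableSingletonClass S]
    [MeasurableSingletonClass A] (M : MDP S A) (b : S → PMF A) (s : S) (a : A) :
    Measure (Path S A) :=
  Kernel.trajMeasure (X := fun _ => Obs S A) (Measure.dirac ((0, s, a) : Obs S A))
    (M.stepKernel b)

/-- The state value function `v_π(s) = E_π[G_0 | S_0 = s]`. -/
def MDP.value [MeasurableSpace S] [MeasurableSpace A] [MeasurableSingletonClass S]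
    [MeasurableSingletonClass A] (M : MDP S A) (π : S → PMF A) (s : S) : ℝ :=
  ∫ ω, M.discountedReturn ω ∂(M.pathLaw π (PMF.pure s))

/-- The action value function `q_π(s, a) = E_π[G_0 | S_0 = s, A_0 = a]`. -/
def MDP.actionValue [MeasurableSpace S] [MeasurableSpace A] [MeasurableSingletonClass S]
    [MeasurableSingletonClass A] (M : MDP S A) (π : S → PMF A) (s : S) (a : A) : ℝ :=
  ∫ ω, M.discountedReturn ω ∂(M.pathLawFrom π s a)

/-- `d` is the limiting distribution of states under the policy `b` started from `ν`:
`d(s) = lim_{t → ∞} P(S_t = s)`. -/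
def MDP.IsLimitingDistribution [MeasurableSpace S] [MeasurableSpace A]
    [MeasurableSingletonClass S] [MeasurableSingletonClass A] (M : MDP S A) (b : S → PMF A)
    (ν : PMF S) (d : S → ℝ) : Prop :=
  ∀ s, Tendsto (fun t : ℕ => (M.pathLaw b ν).real {ω | stateAt t ω = s}) atTop (𝓝 (d s))

/-- The emphatically weighted actor update `ρ_t M_t δ_t ∇_θ ln π(S_t, A_t; θ)`, where `δ_t` uses
the true value function of the target policy. -/
def MDP.actorUpdate [MeasurableSpace S] [MeasurableSpace A] [MeasurableSingletonClass S]
    [MeasurableSingletonClass A] {d : ℕ} (M : MDP S A)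
    (π : EuclideanSpace ℝ (Fin d) → S → PMF A) (θ : EuclideanSpace ℝ (Fin d)) (μ : S → PMF A)
    (i : S → ℝ) (lam : ℝ) (t : ℕ) (ω : Path S A) : EuclideanSpace ℝ (Fin d) :=
  (ratioAt (π θ) μ t ω * M.emphasis (π θ) μ i lam t ω * M.tdError (M.value (π θ)) t ω) •
    gradient (fun ϑ => Real.log (π ϑ (stateAt t ω) (actionAt t ω)).toReal) θ

end

section Matrices

variable {S A : Type*} [Fintype A]

/-- The state transition matrix of the Markov chain induced by the policy `b`. -/
def MDP.transMatrix (M : MDP S A) (b : S → PMF A) : Matrix S S ℝ :=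
  Matrix.of fun s s' => ∑ a : A, (b s a).toReal * (M.P s a s').toReal

/-- The matrix `P_{π,γ}(s, s') = ∑_a π(s, a) P(s, a, s') γ(s, a, s')`. -/
def MDP.discMatrix (M : MDP S A) (π : S → PMF A) : Matrix S S ℝ :=
  Matrix.of fun s s' => ∑ a : A, (π s a).toReal * (M.P s a s').toReal * M.γ s a s'

/-- Yu's conditions on the MDP, the target policy `π` and the behaviour policy `μ`. -/
structure MDP.YuConditions [Fintype S] [DecidableEq S] (M : MDP S A) (π μ : S → PMF A) :
    Prop where
  isUnit : IsUnit (1 - M.discMatrix π)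
  irreducible : (M.transMatrix μ).IsIrreducible
  coverage : ∀ s a, μ s a = 0 → π s a = 0

/-- The emphatic weighting `mᵀ = iᵀ (I - P_{π,γ})⁻¹`, with vector `i(s) = d(s) i(s)`. -/
def MDP.emphaticWeighting [Fintype S] [DecidableEq S] (M : MDP S A) (π : S → PMF A)
    (d i : S → ℝ) : S → ℝ :=
  Matrix.vecMul (fun s => d s * i s) (1 - M.discMatrix π)⁻¹

/-- The emphatic weighting with trace parameter,
`m_λᵀ = iᵀ (I - P_{π,γ})⁻¹ (I - (1 - λ) P_{π,γ})`. -/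
def MDP.emphaticWeightingTrace [Fintype S] [DecidableEq S] (M : MDP S A) (π : S → PMF A)
    (d i : S → ℝ) (lam : ℝ) : S → ℝ :=
  Matrix.vecMul (fun s => d s * i s)
    ((1 - M.discMatrix π)⁻¹ * (1 - (1 - lam) • M.discMatrix π))

end Matrices

end OffPolicy

end

/-!
Write `E[Z 1{S_t = s, A_t = a}]` for a quantity `Z` determined by the states and actions up to time
`t`. When `Z` is multiplied by a weight of the next transition, this moment evolves linearly, and
under coverage the weight `γ_{t+1} ρ_t` turns the transitions of `μ` into the matrix `P_{π,γ}`.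
Hence the vector `f_t(s) = E[F_t 1{S_t = s}]` satisfies `f_{t+1} = f_t P_{π,γ} + i d_{t+1}`, where
`d_t(s) = P(S_t = s)`. The matrix `P_{π,γ}` is substochastic and `1 - P_{π,γ}` is invertible, so its
powers tend to `0`, its Neumann series converges absolutely, and `f_t` tends to `m`.

The same moments with `μ = π` sum the series of discounted rewards and give the Bellman equation
`q_π(s, a) = E[R_1 + γ_1 v_π(S_1) | S_0 = s, A_0 = a]`. So the mean of `δ_t` given the past and
`(S_t, A_t) = (s, a)` is `q_π(s, a) - v_π(s)`, and the baseline `v_π(s)` disappears since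
`∑ a, ∇π(s, a) = 0`.
-/

noncomputable section

namespace OffPolicy

section Convolution

open Finset.HasAntidiagonal (antidiagonal)

theorem tendsto_sum_antidiagonal_mul {R : Type*} [NormedRing R] [CompleteSpace R] {g a : ℕ → R}
    {l : R} (hg : Tendsto g atTop (𝓝 l)) (ha : Summable fun n => ‖a n‖) :
    Tendsto (fun t => ∑ p ∈ antidiagonal t, g p.1 * a p.2) atTop (𝓝 (l * ∑' n, a n)) := by
  obtain ⟨C, hC⟩ := (Metric.isBounded_range_of_tendsto g hg).exists_norm_le
  let F : ℕ → ℕ → R := fun t => (Finset.range (t + 1) : Set ℕ).indicator fun k => g (t - k) * a k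
  have hF_le : ∀ t k, ‖F t k‖ ≤ C * ‖a k‖ := fun t k =>
    (norm_indicator_le_norm_self _ _).trans <| (norm_mul_le _ _).trans <|
      mul_le_mul_of_nonneg_right (hC _ ⟨_, rfl⟩) (norm_nonneg _)
  have hF_lim : ∀ k, Tendsto (F · k) atTop (𝓝 (l * a k)) := fun k =>
    ((hg.comp (tendsto_sub_atTop_nat k)).mul_const (a k)).congr' <| by
      filter_upwards [eventually_ge_atTop k] with t ht
      simp [F, ht]
  have hF_sum : ∀ t, ∑' k, F t k = ∑ p ∈ antidiagonal t, g p.1 * a p.2 := fun t => by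
    rw [← Finset.Nat.sum_antidiagonal_swap, Finset.Nat.sum_antidiagonal_eq_sum_range_succ_mk]
    exact (sum_eq_tsum_indicator _ _).symm
  rw [← ha.of_norm.tsum_mul_left]
  exact (tendsto_tsum_of_dominated_convergence (ha.mul_left C) hF_lim
    (Eventually.of_forall fun t => hF_le t)).congr hF_sum

end Convolution

section Substochastic

open Matrix
open Finset.HasAntidiagonal (antidiagonal)

/-- A substochastic matrix: the one-step transition matrix of a chain that may be killed, such as
`P_{π,γ}` when the discount is read as a survival probability. -/
structure IsSubstochastic {X : Type*} [Fintype X] (Q : Matrix X X ℝ) : Prop where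
  nonneg : ∀ x y, 0 ≤ Q x y
  sum_le_one : ∀ x, ∑ y, Q x y ≤ 1

variable {X : Type*} [Fintype X] [DecidableEq X] {Q : Matrix X X ℝ}

theorem IsSubstochastic.antitone_pow_mulVec_one (hQ : IsSubstochastic Q) :
    Antitone fun n : ℕ => Q ^ n *ᵥ 1 := by
  refine antitone_nat_of_succ_le fun n x => ?_
  rw [pow_succ, ← mulVec_mulVec]
  refine Finset.sum_le_sum fun y _ =>
    mul_le_mul_of_nonneg_left ?_ (pow_apply_nonneg hQ.nonneg n x y)
  simpa [mulVec, dotProduct] using hQ.sum_le_one y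

-- The survival probabilities `Q ^ n *ᵥ 1` decrease to a vector fixed by `Q`, which is zero.
theorem IsSubstochastic.tendsto_pow_mulVec_one (hQ : IsSubstochastic Q) (hU : IsUnit (1 - Q)) :
    Tendsto (fun n : ℕ => Q ^ n *ᵥ (1 : X → ℝ)) atTop (𝓝 0) := by
  obtain ⟨l, hl⟩ : ∃ l, Tendsto (fun n : ℕ => Q ^ n *ᵥ (1 : X → ℝ)) atTop (𝓝 l) := by
    refine ⟨fun x => ⨅ n : ℕ, (Q ^ n *ᵥ 1) x, tendsto_pi_nhds.2 fun x =>
      tendsto_atTop_ciInf (fun _ _ h => hQ.antitone_pow_mulVec_one h x) ⟨0, ?_⟩⟩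
    rintro _ ⟨n, rfl⟩
    exact Finset.sum_nonneg fun y _ => mul_nonneg (pow_apply_nonneg hQ.nonneg n x y) zero_le_one
  have h_fixed : Q *ᵥ l = l := by
    refine tendsto_nhds_unique ?_ (hl.comp (tendsto_add_atTop_nat 1))
    refine (((Continuous.matrix_mulVec continuous_const continuous_id).tendsto l).comp hl).congr
      fun n => ?_
    simp only [Function.comp_apply, id_eq, mulVec_mulVec, pow_succ']
  have h_zero : l = 0 := mulVec_injective_of_isUnit hU <| by
    rw [sub_mulVec, one_mulVec, h_fixed, sub_self, mulVec_zero]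
  exact h_zero ▸ hl

theorem IsSubstochastic.tendsto_pow (hQ : IsSubstochastic Q) (hU : IsUnit (1 - Q)) :
    Tendsto (fun n : ℕ => Q ^ n) atTop (𝓝 0) := by
  refine tendsto_pi_nhds.2 fun x => tendsto_pi_nhds.2 fun y =>
    squeeze_zero (fun n => pow_apply_nonneg hQ.nonneg n x y) (fun n => ?_)
      (tendsto_pi_nhds.1 (hQ.tendsto_pow_mulVec_one hU) x)
  simpa [mulVec, dotProduct] using Finset.single_le_sum
    (fun z _ => pow_apply_nonneg hQ.nonneg n x z) (Finset.mem_univ y)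

theorem IsSubstochastic.hasSum_pow (hQ : IsSubstochastic Q) (hU : IsUnit (1 - Q)) :
    HasSum (fun n : ℕ => Q ^ n) (1 - Q)⁻¹ := by
  have h_geom : ∀ n : ℕ, (1 - Q ^ n) * (1 - Q)⁻¹ = ∑ k ∈ Finset.range n, Q ^ k := fun n => by
    rw [← geom_sum_mul_neg, mul_assoc, mul_nonsing_inv _ ((isUnit_iff_isUnit_det _).1 hU), mul_one]
  have h_lim : Tendsto (fun n : ℕ => ∑ k ∈ Finset.range n, Q ^ k) atTop (𝓝 (1 - Q)⁻¹) := by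
    simpa only [sub_zero, one_mul, h_geom] using
      ((hQ.tendsto_pow hU).const_sub 1).mul_const (1 - Q)⁻¹
  refine Pi.hasSum.2 fun x => Pi.hasSum.2 fun y => ?_
  rw [hasSum_iff_tendsto_nat_of_nonneg fun n => pow_apply_nonneg hQ.nonneg n x y]
  simpa only [Matrix.sum_apply] using tendsto_pi_nhds.1 (tendsto_pi_nhds.1 h_lim x) y

theorem eq_vecMul_pow_add_sum_antidiagonal {f g : ℕ → X → ℝ}
    (hf : ∀ t, f (t + 1) = f t ᵥ* Q + g t) (t : ℕ) :
    f (t + 1) = f 0 ᵥ* Q ^ (t + 1) + ∑ p ∈ antidiagonal t, g p.1 ᵥ* Q ^ p.2 := by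
  induction t with
  | zero => simp [hf]
  | succ t ih =>
    rw [hf, ih, add_vecMul, vecMul_vecMul, ← pow_succ, sum_vecMul,
      Finset.Nat.sum_antidiagonal_succ', pow_zero, vecMul_one]
    simp only [vecMul_vecMul, ← pow_succ, add_assoc, add_comm (g (t + 1))]

theorem IsSubstochastic.tendsto_of_affine_recursion (hQ : IsSubstochastic Q) (hU : IsUnit (1 - Q))
    {f g : ℕ → X → ℝ} {l : X → ℝ} (hf : ∀ t, f (t + 1) = f t ᵥ* Q + g t)
    (hg : Tendsto g atTop (𝓝 l)) : Tendsto f atTop (𝓝 (l ᵥ* (1 - Q)⁻¹)) := by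
  have h_pow : ∀ x y, HasSum (fun n => (Q ^ n) x y) ((1 - Q)⁻¹ x y) := fun x y =>
    Pi.hasSum.1 (Pi.hasSum.1 (hQ.hasSum_pow hU) x) y
  have h_init : Tendsto (fun t => f 0 ᵥ* Q ^ (t + 1)) atTop (𝓝 0) := by
    have h_cont : Continuous fun B : Matrix X X ℝ => f 0 ᵥ* B :=
      continuous_const.matrix_vecMul continuous_id
    simpa only [vecMul_zero, Function.comp_def] using
      (h_cont.tendsto 0).comp ((hQ.tendsto_pow hU).comp (tendsto_add_atTop_nat 1))
  have h_source : Tendsto (fun t => ∑ p ∈ antidiagonal t, g p.1 ᵥ* Q ^ p.2) atTop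
      (𝓝 (l ᵥ* (1 - Q)⁻¹)) := by
    refine tendsto_pi_nhds.2 fun y => ?_
    simp only [Finset.sum_apply, vecMul, dotProduct]
    simp only [Finset.sum_comm (s := antidiagonal _), ← fun x => (h_pow x y).tsum_eq]
    exact tendsto_finsetSum _ fun x _ => tendsto_sum_antidiagonal_mul (tendsto_pi_nhds.1 hg x)
      (h_pow x y).summable.norm
  rw [← tendsto_add_atTop_iff_nat 1]
  simpa only [eq_vecMul_pow_add_sum_antidiagonal hf, zero_add] using h_init.add h_source

end Substochastic

section Trajectories

open Finset Preorder

theorem restrict_prod_univ_compProd_eq_prod {α β : Type*} [MeasurableSpace α] [MeasurableSpace β]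
    {ρ : Measure α} [SFinite ρ] {κ : Kernel α β} [IsSFiniteKernel κ] {m : Measure β} [SFinite m]
    {s : Set α} (hs : MeasurableSet s) (hκ : ∀ a ∈ s, κ a = m) :
    (ρ ⊗ₘ κ).restrict (s ×ˢ Set.univ) = (ρ.restrict s).prod m :=
  calc (ρ ⊗ₘ κ).restrict (s ×ˢ Set.univ)
      = ρ.restrict s ⊗ₘ κ := by
        rw [Measure.compProd, ← Kernel.restrict_apply _ (hs.prod .univ),
          ← Kernel.compProd_restrict_left hs, Measure.compProd]
        congr 2
    _ = ρ.restrict s ⊗ₘ Kernel.const α m :=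
        Measure.compProd_congr (ae_restrict_of_forall_mem hs hκ)
    _ = (ρ.restrict s).prod m := Measure.compProd_const

variable {X : ℕ → Type*} [∀ n, MeasurableSpace (X n)]
  {κ : (n : ℕ) → Kernel (Π i : Iic n, X i) (X (n + 1))} [∀ n, IsMarkovKernel (κ n)]
  {μ₀ : Measure (X 0)}

theorem map_zero_trajMeasure : (Kernel.trajMeasure μ₀ κ).map (fun ω => ω 0) = μ₀ := by
  have h : (fun ω : Π n, X n => ω 0) =
      (fun y : Π i : Iic 0, X i => y ⟨0, mem_Iic.2 le_rfl⟩) ∘ frestrictLe 0 := rfl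
  rw [h, ← Measure.map_map (by fun_prop) (by fun_prop), Kernel.trajMeasure,
    Measure.map_comp _ _ (by fun_prop), Kernel.traj_map_frestrictLe, Kernel.partialTraj_self,
    Measure.id_comp]
  exact (Measure.map_map (by fun_prop) (MeasurableEquiv.measurable _)).trans Measure.map_id

variable [IsProbabilityMeasure μ₀] {t : ℕ} {s : Set (Π i : Iic t, X i)} {m : Measure (X (t + 1))}
  [SFinite m]

theorem map_restrict_trajMeasure_eq_prod (hs : MeasurableSet s) (hκ : ∀ h ∈ s, κ t h = m) :
    ((Kernel.trajMeasure μ₀ κ).restrict (frestrictLe t ⁻¹' s)).map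
        (fun ω => (frestrictLe t ω, ω (t + 1))) =
      (((Kernel.trajMeasure μ₀ κ).map (frestrictLe t)).restrict s).prod m := by
  rw [← restrict_prod_univ_compProd_eq_prod hs hκ,
    Kernel.map_frestrictLe_trajMeasure_compProd_eq_map_trajMeasure,
    Measure.restrict_map (by fun_prop) (hs.prod .univ)]
  simp only [Set.preimage, Set.mem_prod, Set.mem_univ, and_true]

variable {E : Type*} [NormedAddCommGroup E] [NormedSpace ℝ E]

theorem integrableOn_and_setIntegral_trajMeasure_smul (hs : MeasurableSet s)
    (hκ : ∀ h ∈ s, κ t h = m) {u : (Π i : Iic t, X i) → ℝ} {φ : X (t + 1) → E}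
    (hu : Integrable u ((Kernel.trajMeasure μ₀ κ).map (frestrictLe t))) (hφ : Integrable φ m) :
    IntegrableOn (fun ω => u (frestrictLe t ω) • φ (ω (t + 1))) (frestrictLe t ⁻¹' s)
        (Kernel.trajMeasure μ₀ κ) ∧
      ∫ ω in frestrictLe t ⁻¹' s, u (frestrictLe t ω) • φ (ω (t + 1)) ∂Kernel.trajMeasure μ₀ κ =
        (∫ ω in frestrictLe t ⁻¹' s, u (frestrictLe t ω) ∂Kernel.trajMeasure μ₀ κ) •
          ∫ o, φ o ∂m := by
  have h_prod := map_restrict_trajMeasure_eq_prod (μ₀ := μ₀) hs hκ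
  have h_int := hu.restrict (s := s) |>.smul_prod hφ
  have h_pair : Measurable fun ω : Π n, X n => (frestrictLe t ω, ω (t + 1)) := by fun_prop
  rw [← h_prod] at h_int
  refine ⟨h_int.comp_measurable h_pair, ?_⟩
  rw [← setIntegral_map hs hu.1 (measurable_frestrictLe t).aemeasurable, ← integral_prod_smul,
    ← h_prod, integral_map h_pair.aemeasurable h_int.1]

end Trajectories

section OneStepLaws

instance isProbabilityMeasure_startLaw {S A : Type*} [Fintype S] [Fintype A] [MeasurableSpace S]
    [MeasurableSpace A] (b : S → PMF A) (ν : PMF S) : IsProbabilityMeasure (startLaw b ν) := by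
  constructor
  simp only [startLaw, Measure.coe_finsetSum, Finset.sum_apply, Measure.smul_apply,
    measure_univ, smul_eq_mul, mul_one, ← Finset.mul_sum, pmf_sum_eq_one]

variable {S A : Type*} [MeasurableSpace S] [MeasurableSpace A] [MeasurableSingletonClass S]
  [MeasurableSingletonClass A]

section Integral

variable {E : Type*} [NormedAddCommGroup E] {M : MDP S A} {x : S × A} {ψ : Obs S A → E}

theorem MDP.integrable_smul_map_rewardLaw (b : S → PMF A) {s' : S} {a' : A}
    (hψ : Integrable (fun r => ψ (r, s', a')) (M.rewardLaw x.1 x.2 s')) :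
    Integrable ψ ((M.P x.1 x.2 s' * b s' a') •
      (M.rewardLaw x.1 x.2 s').map fun r => ((r, s', a') : Obs S A)) :=
  ((measurableEmbedding_prod_mk_right (s', a')).integrable_map_iff.2 hψ).smul_measure
    (ENNReal.mul_ne_top (PMF.apply_ne_top _ _) (PMF.apply_ne_top _ _))

variable [Fintype S] [Fintype A]

theorem MDP.integrable_stepLaw (b : S → PMF A)
    (hψ : ∀ s' a', Integrable (fun r => ψ (r, s', a')) (M.rewardLaw x.1 x.2 s')) :
    Integrable ψ (M.stepLaw b x) :=
  integrable_finsetSum_measure.2 fun s' _ => integrable_finsetSum_measure.2 fun a' _ =>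
    M.integrable_smul_map_rewardLaw b (hψ s' a')

theorem MDP.integral_stepLaw [NormedSpace ℝ E] (b : S → PMF A)
    (hψ : ∀ s' a', Integrable (fun r => ψ (r, s', a')) (M.rewardLaw x.1 x.2 s')) :
    ∫ o, ψ o ∂M.stepLaw b x = ∑ s', ∑ a', ((M.P x.1 x.2 s').toReal * (b s' a').toReal) •
      ∫ r, ψ (r, s', a') ∂M.rewardLaw x.1 x.2 s' := by
  have h := fun s' a' => M.integrable_smul_map_rewardLaw b (hψ s' a')
  rw [stepLaw, integral_finsetSum_measure fun s' _ =>
    integrable_finsetSum_measure.2 fun a' _ => h s' a']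
  refine Finset.sum_congr rfl fun s' _ => ?_
  rw [integral_finsetSum_measure fun a' _ => h s' a']
  refine Finset.sum_congr rfl fun a' _ => ?_
  rw [integral_smul_measure, (measurableEmbedding_prod_mk_right (s', a')).integral_map,
    ENNReal.toReal_mul]

end Integral

theorem measurableSet_snd_eq (x : S × A) : MeasurableSet {o : Obs S A | o.2 = x} :=
  measurable_snd (measurableSet_singleton x)

variable [Fintype S] [Fintype A]

theorem MDP.stepLaw_real_snd_eq (M : MDP S A) (b : S → PMF A) (x : S × A) (s' : S) (a' : A) :
    (M.stepLaw b x).real {o | o.2 = (s', a')} =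
      (M.P x.1 x.2 s').toReal * (b s' a').toReal := by
  classical
  have hP := M.isProbabilityMeasure_rewardLaw x.1 x.2
  have h_int : ∀ (y : S) (a : A), Integrable
      (fun r => {o : Obs S A | o.2 = (s', a')}.indicator (1 : Obs S A → ℝ) (r, y, a))
      (M.rewardLaw x.1 x.2 y) :=
    fun y a => by simp [Set.indicator_apply]
  rw [← integral_indicator_one (measurableSet_snd_eq _), M.integral_stepLaw b h_int]
  simp [Set.indicator_apply, ite_and]

theorem startLaw_real_snd_eq (b : S → PMF A) (ν : PMF S) (s : S) (a : A) :
    (startLaw b ν).real {o | o.2 = (s, a)} = (ν s).toReal * (b s a).toReal := by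
  classical
  simp [startLaw, measureReal_def, Measure.dirac_apply' _ (measurableSet_snd_eq _),
    Set.indicator_apply, ite_and]

end OneStepLaws

section HistoryFunctions

variable {S A : Type*}

/-- `Z` is determined by the states and actions up to time `t`. The rewards are left out, so that
over finite state and action sets such a `Z` is a function on a finite set. -/
def IsHistoryFunction (t : ℕ) (Z : Path S A → ℝ) : Prop :=
  ∀ ⦃ω ω' : Path S A⦄, (∀ j ≤ t, (ω j).2 = (ω' j).2) → Z ω = Z ω'

variable {t u : ℕ} {Z W : Path S A → ℝ}

theorem isHistoryFunction_comp_snd {j : ℕ} (hj : j ≤ t) (f : S × A → ℝ) :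
    IsHistoryFunction t fun ω : Path S A => f (ω j).2 :=
  fun _ _ h => congrArg f (h j hj)

theorem isHistoryFunction_transition (t : ℕ) (c : S → A → S → ℝ) : IsHistoryFunction (t + 1)
    fun ω : Path S A => c (stateAt t ω) (actionAt t ω) (stateAt (t + 1) ω) := fun _ _ h => by
  simp only [stateAt, actionAt, h t t.le_succ, h (t + 1) le_rfl]

theorem IsHistoryFunction.mono (hZ : IsHistoryFunction t Z) (htu : t ≤ u) :
    IsHistoryFunction u Z :=
  fun _ _ h => hZ fun j hj => h j (hj.trans htu)

theorem IsHistoryFunction.add (hZ : IsHistoryFunction t Z) (hW : IsHistoryFunction t W) :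
    IsHistoryFunction t fun ω => Z ω + W ω :=
  fun _ _ h => congrArg₂ (· + ·) (hZ h) (hW h)

theorem IsHistoryFunction.mul (hZ : IsHistoryFunction t Z) (hW : IsHistoryFunction t W) :
    IsHistoryFunction t fun ω => Z ω * W ω :=
  fun _ _ h => congrArg₂ (· * ·) (hZ h) (hW h)

theorem IsHistoryFunction.exists_eq_comp (hZ : IsHistoryFunction t Z) :
    ∃ Y : (Finset.Iic t → S × A) → ℝ, Z = Y ∘ fun ω j => (ω j).2 :=
  (Function.factorsThrough_iff Z).1 fun _ _ h =>
    hZ fun j hj => congrFun h ⟨j, Finset.mem_Iic.2 hj⟩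

theorem IsHistoryFunction.integrable [Finite S] [Finite A] [MeasurableSpace S] [MeasurableSpace A]
    [MeasurableSingletonClass S] [MeasurableSingletonClass A] (hZ : IsHistoryFunction t Z)
    (Q : Measure (Path S A)) [IsFiniteMeasure Q] : Integrable Z Q := by
  obtain ⟨Y, rfl⟩ := hZ.exists_eq_comp
  exact Integrable.of_finite.comp_measurable (by fun_prop)

end HistoryFunctions

section Moments

variable {S A : Type*}

/-- The event `(S_t, A_t) = x`. -/
def visitEvent (t : ℕ) (x : S × A) : Set (Path S A) := {ω | (ω t).2 = x}

theorem iUnion_visitEvent (t : ℕ) : ⋃ x, visitEvent t x = (Set.univ : Set (Path S A)) :=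
  Set.iUnion_eq_univ_iff.2 fun ω => ⟨(ω t).2, rfl⟩

theorem iUnion_visitEvent_action (t : ℕ) (s : S) :
    ⋃ a : A, visitEvent t (s, a) = {ω : Path S A | stateAt t ω = s} := by
  ext ω
  simp [visitEvent, stateAt, Prod.ext_iff]

theorem disjoint_visitEvent (t : ℕ) {x y : S × A} (hxy : x ≠ y) :
    Disjoint (visitEvent t x) (visitEvent t y) :=
  Set.disjoint_left.2 fun _ hx hy => hxy (hx.symm.trans hy)

variable [MeasurableSpace S] [MeasurableSpace A]

/-- The moment `E[Z 1{(S_t, A_t) = x}]` of `Z` on the event `(S_t, A_t) = x`. -/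
def moment (Q : Measure (Path S A)) (t : ℕ) (Z : Path S A → ℝ) (x : S × A) : ℝ :=
  ∫ ω in visitEvent t x, Z ω ∂Q

variable [MeasurableSingletonClass S] [MeasurableSingletonClass A]

theorem measurableSet_visitEvent (t : ℕ) (x : S × A) : MeasurableSet (visitEvent t x) :=
  (measurableSet_snd_eq x).preimage (measurable_pi_apply t)

theorem moment_comp_snd_mul (Q : Measure (Path S A)) (t : ℕ) (f : S × A → ℝ) (Z : Path S A → ℝ)
    (x : S × A) : moment Q t (fun ω => f (ω t).2 * Z ω) x = f x * moment Q t Z x := by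
  rw [moment, moment, ← integral_const_mul]
  exact setIntegral_congr_fun (measurableSet_visitEvent t x) fun ω hω =>
    congrArg (fun y => f y * Z ω) hω

variable [Fintype S] [Fintype A]

/-- The law of the trajectory when `(R_0, S_0, A_0)` has law `ν₀` and all later actions are
selected by `b`; both `MDP.pathLaw` and `MDP.pathLawFrom` are of this form. -/
abbrev MDP.law (M : MDP S A) (b : S → PMF A) (ν₀ : Measure (Obs S A)) : Measure (Path S A) :=
  Kernel.trajMeasure (X := fun _ => Obs S A) ν₀ (M.stepKernel b)

theorem MDP.moment_zero_const (M : MDP S A) (b : S → PMF A) (ν₀ : Measure (Obs S A)) (z : ℝ)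
    (x : S × A) : moment (M.law b ν₀) 0 (fun _ => z) x = ν₀.real {o | o.2 = x} * z := by
  have h_zero : (M.law b ν₀).map (fun ω => ω 0) = ν₀ := map_zero_trajMeasure
  rw [moment, setIntegral_const, smul_eq_mul, visitEvent]
  conv_rhs => rw [← h_zero, map_measureReal_apply (by fun_prop) (measurableSet_snd_eq x)]
  rfl

variable (M : MDP S A) (b : S → PMF A) (ν₀ : Measure (Obs S A)) [IsProbabilityMeasure ν₀]
  {t : ℕ} {Z : Path S A → ℝ} {E : Type*} [NormedAddCommGroup E] [NormedSpace ℝ E]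

theorem MDP.integrableOn_and_setIntegral_visitEvent_smul (hZ : IsHistoryFunction t Z) {x : S × A}
    {φ : Obs S A → E} (hφ : Integrable φ (M.stepLaw b x)) :
    IntegrableOn (fun ω => Z ω • φ (ω (t + 1))) (visitEvent t x) (M.law b ν₀) ∧
      ∫ ω in visitEvent t x, Z ω • φ (ω (t + 1)) ∂M.law b ν₀ =
        moment (M.law b ν₀) t Z x • ∫ o, φ o ∂M.stepLaw b x := by
  obtain ⟨Y, rfl⟩ := hZ.exists_eq_comp
  have : IsProbabilityMeasure ((M.law b ν₀).map (Preorder.frestrictLe t)) :=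
    Measure.isProbabilityMeasure_map (by fun_prop)
  have hY : Integrable (fun h : Finset.Iic t → Obs S A => Y fun j => (h j).2)
      ((M.law b ν₀).map (Preorder.frestrictLe t)) :=
    (Integrable.of_finite (f := Y)).comp_measurable (by fun_prop)
  let now : Finset.Iic t := ⟨t, Finset.mem_Iic.2 le_rfl⟩
  have hs : MeasurableSet {h : Finset.Iic t → Obs S A | (h now).2 = x} :=
    (measurableSet_snd_eq x).preimage (measurable_pi_apply now)
  have hκ : ∀ h ∈ {h : Finset.Iic t → Obs S A | (h now).2 = x},
      M.stepKernel b t h = M.stepLaw b x := fun _ hh => congrArg (M.stepLaw b) hh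
  exact integrableOn_and_setIntegral_trajMeasure_smul (X := fun _ => Obs S A) hs hκ hY hφ

theorem MDP.integrable_and_integral_step_smul (hZ : IsHistoryFunction t Z)
    {φ : S × A → Obs S A → E} (hφ : ∀ x, Integrable (φ x) (M.stepLaw b x)) :
    Integrable (fun ω => Z ω • φ (ω t).2 (ω (t + 1))) (M.law b ν₀) ∧
      ∫ ω, Z ω • φ (ω t).2 (ω (t + 1)) ∂M.law b ν₀ =
        ∑ x, moment (M.law b ν₀) t Z x • ∫ o, φ x o ∂M.stepLaw b x := by
  have h_visit := fun x => M.integrableOn_and_setIntegral_visitEvent_smul b ν₀ hZ (hφ x)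
  have h_eq : ∀ x, Set.EqOn (fun ω => Z ω • φ (ω t).2 (ω (t + 1)))
      (fun ω => Z ω • φ x (ω (t + 1))) (visitEvent t x) := fun x ω hω =>
    congrArg (fun y => Z ω • φ y (ω (t + 1))) hω
  have h_on : ∀ x, IntegrableOn (fun ω => Z ω • φ (ω t).2 (ω (t + 1))) (visitEvent t x)
      (M.law b ν₀) := fun x =>
    (h_visit x).1.congr_fun (h_eq x).symm (measurableSet_visitEvent t x)
  rw [← integrableOn_univ, ← setIntegral_univ, ← iUnion_visitEvent t]
  refine ⟨integrableOn_finite_iUnion.2 h_on, ?_⟩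
  rw [integral_iUnion_fintype (measurableSet_visitEvent t)
    (fun _ _ => disjoint_visitEvent t) h_on]
  exact Finset.sum_congr rfl fun x _ =>
    (setIntegral_congr_fun (measurableSet_visitEvent t x) (h_eq x)).trans (h_visit x).2

theorem MDP.moment_transition_mul (hZ : IsHistoryFunction t Z) (c : S → A → S → ℝ) (s' : S)
    (a' : A) :
    moment (M.law b ν₀) (t + 1)
        (fun ω => c (stateAt t ω) (actionAt t ω) (stateAt (t + 1) ω) * Z ω) (s', a') =
      (∑ x, moment (M.law b ν₀) t Z x * ((M.P x.1 x.2 s').toReal * c x.1 x.2 s')) *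
        (b s' a').toReal := by
  let next : Set (Obs S A) := {o | o.2 = (s', a')}
  have h_next : MeasurableSet next := measurableSet_snd_eq _
  have h_step := (M.integrable_and_integral_step_smul b ν₀ hZ
    (φ := fun x => next.indicator fun _ => c x.1 x.2 s')
    fun x => (integrable_const _).indicator h_next).2
  rw [moment, ← integral_indicator (measurableSet_visitEvent _ _), Finset.sum_mul]
  convert h_step using 2 with x _
  · ext ω
    by_cases hω : (ω (t + 1)).2 = (s', a')
    · simp [visitEvent, next, hω, stateAt, actionAt, mul_comm]
    · simp [visitEvent, next, hω]
  · rw [integral_indicator_const _ h_next, M.stepLaw_real_snd_eq, smul_eq_mul, smul_eq_mul]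
    ring

end Moments

section StateMoments

variable {S A : Type*}

/-- `HasStateMoment Q b t Z f` says that `E[Z 1{S_t = s}] = f s` and that, given `S_t`, the action
`A_t` is drawn from `b S_t` independently of `Z`. -/
def HasStateMoment [MeasurableSpace S] [MeasurableSpace A] (Q : Measure (Path S A))
    (b : S → PMF A) (t : ℕ) (Z : Path S A → ℝ) (f : S → ℝ) : Prop :=
  ∀ s a, moment Q t Z (s, a) = f s * (b s a).toReal

/-- The one-step transition matrix under the policy `b` with each transition weighted by `c`;
`P_{π,γ}` is the case `b = π`, `c = γ`. -/
def MDP.weightedMatrix [Fintype A] (M : MDP S A) (b : S → PMF A) (c : S → A → S → ℝ) :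
    Matrix S S ℝ :=
  Matrix.of fun s s' => ∑ a, (b s a).toReal * (M.P s a s').toReal * c s a s'

theorem sum_toReal_pmf [Fintype A] (p : PMF A) : ∑ a, (p a).toReal = 1 := by
  rw [← ENNReal.toReal_sum fun a _ => p.apply_ne_top a, pmf_sum_eq_one, ENNReal.toReal_one]

variable [MeasurableSpace S] [MeasurableSpace A]

section AnyLaw

variable {Q : Measure (Path S A)} {b : S → PMF A} {t : ℕ} {Z W : Path S A → ℝ} {f g : S → ℝ}

theorem HasStateMoment.add (hf : HasStateMoment Q b t Z f) (hg : HasStateMoment Q b t W g)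
    (hZ : Integrable Z Q) (hW : Integrable W Q) :
    HasStateMoment Q b t (fun ω => Z ω + W ω) (f + g) := fun s a => by
  rw [moment, integral_add hZ.integrableOn hW.integrableOn, Pi.add_apply, add_mul, ← hf s a,
    ← hg s a, moment, moment]

variable [MeasurableSingletonClass S] [MeasurableSingletonClass A]

theorem HasStateMoment.state_mul (hf : HasStateMoment Q b t Z f) (e : S → ℝ) :
    HasStateMoment Q b t (fun ω => e (stateAt t ω) * Z ω) (e * f) := fun s a => by
  rw [Pi.mul_apply, mul_assoc, ← hf s a]
  exact moment_comp_snd_mul Q t (fun x => e x.1) Z (s, a)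

theorem HasStateMoment.setIntegral_eq [Finite A] (hf : HasStateMoment Q b t Z f)
    (hZ : Integrable Z Q) (s : S) : ∫ ω in {ω | stateAt t ω = s}, Z ω ∂Q = f s := by
  have := Fintype.ofFinite A
  rw [← iUnion_visitEvent_action t s, integral_iUnion_fintype
    (fun a => measurableSet_visitEvent t (s, a))
    (fun a a' h => disjoint_visitEvent t (by simpa using h)) fun _ => hZ.integrableOn]
  exact (Finset.sum_congr rfl fun a _ => hf s a).trans <| by
    rw [← Finset.mul_sum, sum_toReal_pmf, mul_one]

end AnyLaw

variable [MeasurableSingletonClass S] [MeasurableSingletonClass A] [Fintype S] [Fintype A]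
  {M : MDP S A} {b : S → PMF A}

section TrajectoryLaw

variable {ν₀ : Measure (Obs S A)} [IsProbabilityMeasure ν₀] {t : ℕ} {Z : Path S A → ℝ}
  {f : S → ℝ}

theorem IsHistoryFunction.hasStateMoment_transition_mul (hZ : IsHistoryFunction t Z)
    (c : S → A → S → ℝ) : HasStateMoment (M.law b ν₀) b (t + 1)
      (fun ω => c (stateAt t ω) (actionAt t ω) (stateAt (t + 1) ω) * Z ω)
      fun s' => ∑ x, moment (M.law b ν₀) t Z x * ((M.P x.1 x.2 s').toReal * c x.1 x.2 s') :=
  M.moment_transition_mul b ν₀ hZ c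

theorem HasStateMoment.transition_mul (hf : HasStateMoment (M.law b ν₀) b t Z f)
    (hZ : IsHistoryFunction t Z) (c : S → A → S → ℝ) : HasStateMoment (M.law b ν₀) b (t + 1)
      (fun ω => c (stateAt t ω) (actionAt t ω) (stateAt (t + 1) ω) * Z ω)
      (Matrix.vecMul f (M.weightedMatrix b c)) := by
  convert hZ.hasStateMoment_transition_mul (M := M) (b := b) (ν₀ := ν₀) c using 1
  ext s'
  simp only [Matrix.vecMul, dotProduct, MDP.weightedMatrix, Matrix.of_apply, Finset.mul_sum,
    Fintype.sum_prod_type, hf _ _]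
  exact Finset.sum_congr rfl fun s _ => Finset.sum_congr rfl fun a _ => by ring

end TrajectoryLaw

instance MDP.isProbabilityMeasure_pathLaw (M : MDP S A) (b : S → PMF A) (ν : PMF S) :
    IsProbabilityMeasure (M.pathLaw b ν) :=
  inferInstanceAs (IsProbabilityMeasure (M.law b (startLaw b ν)))

/-- The law of `S_t`, as the vector of its point masses, when `S_0` is drawn from `ν` and all
actions are selected by `b`. -/
def MDP.stateLaw (M : MDP S A) (b : S → PMF A) (ν : PMF S) (t : ℕ) : S → ℝ :=
  fun s => (M.pathLaw b ν).real {ω | stateAt t ω = s}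

theorem MDP.hasStateMoment_one_pathLaw (M : MDP S A) (b : S → PMF A) (ν : PMF S) (t : ℕ) :
    HasStateMoment (M.pathLaw b ν) b t (fun _ => 1) (M.stateLaw b ν t) := by
  obtain ⟨f, hf⟩ : ∃ f, HasStateMoment (M.law b (startLaw b ν)) b t (fun _ => 1) f := by
    cases t with
    | zero =>
      refine ⟨fun s => (ν s).toReal, fun s a => ?_⟩
      rw [M.moment_zero_const, startLaw_real_snd_eq, mul_one]
    | succ t =>
      have h_one : IsHistoryFunction t fun _ : Path S A => 1 :=
        isHistoryFunction_comp_snd le_rfl fun _ => 1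
      exact ⟨_, by simpa only [mul_one] using h_one.hasStateMoment_transition_mul fun _ _ _ => 1⟩
  obtain rfl : f = M.stateLaw b ν t := funext fun s => by
    rw [← hf.setIntegral_eq (integrable_const 1) s, setIntegral_const, smul_eq_mul, mul_one]
    rfl
  exact hf

end StateMoments

section Values

open Matrix

variable {S A : Type*}

/-- The discount product `γ_1 ⋯ γ_k`. -/
def MDP.discountProd (M : MDP S A) (k : ℕ) (ω : Path S A) : ℝ :=
  ∏ j ∈ Finset.range k, M.discountAfter j ω

/-- The one-step backup `E[g(R_{t+1}) + γ_{t+1} v(S_{t+1}) | S_t = s, A_t = a]`. The return needs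
`g = id`, and its absolute convergence `g = |·|`. -/
def MDP.backup [Fintype S] (M : MDP S A) (g : ℝ → ℝ) (v : S → ℝ) (s : S) (a : A) : ℝ :=
  ∑ s', (M.P s a s').toReal * (∫ r, g r ∂M.rewardLaw s a s' + M.γ s a s' * v s')

/-- The solution `v = (1 - P_{π,γ})⁻¹ r_π` of the linear system `v s = ∑ a, π s a * backup g v s a`;
for `g = id` it is the value function. -/
def MDP.resolventValue [Fintype S] [DecidableEq S] [Fintype A] (M : MDP S A) (π : S → PMF A)
    (g : ℝ → ℝ) : S → ℝ :=
  (1 - M.discMatrix π)⁻¹ *ᵥ fun s => ∑ a, (π s a).toReal * M.backup g 0 s a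

variable {M : MDP S A} {π : S → PMF A} {g : ℝ → ℝ}

theorem MDP.discountProd_nonneg (M : MDP S A) (k : ℕ) (ω : Path S A) : 0 ≤ M.discountProd k ω :=
  Finset.prod_nonneg fun _ _ => M.γ_nonneg _ _ _

theorem MDP.discountProd_succ (M : MDP S A) (k : ℕ) :
    M.discountProd (k + 1) = fun ω => M.discountAfter k ω * M.discountProd k ω :=
  funext fun _ => Finset.prod_range_succ_comm _ _

theorem MDP.isHistoryFunction_discountProd (M : MDP S A) (k : ℕ) :
    IsHistoryFunction k (M.discountProd k) := by
  induction k with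
  | zero => exact fun _ _ _ => rfl
  | succ k ih =>
    rw [discountProd_succ]
    exact (isHistoryFunction_transition k M.γ).mul (ih.mono k.le_succ)

variable [Fintype S]

theorem MDP.backup_eq_backup_zero_add (M : MDP S A) (g : ℝ → ℝ) (v : S → ℝ) (s : S) (a : A) :
    M.backup g v s a = M.backup g 0 s a + ∑ s', (M.P s a s').toReal * M.γ s a s' * v s' := by
  simp only [backup, Pi.zero_apply, mul_zero, add_zero, mul_add, Finset.sum_add_distrib, mul_assoc]

theorem MDP.isSubstochastic_discMatrix [Fintype A] (M : MDP S A) (π : S → PMF A) :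
    IsSubstochastic (M.discMatrix π) where
  nonneg s s' := Finset.sum_nonneg fun a _ =>
    mul_nonneg (mul_nonneg ENNReal.toReal_nonneg ENNReal.toReal_nonneg) (M.γ_nonneg s a s')
  sum_le_one s := calc
    ∑ s', M.discMatrix π s s' ≤ ∑ s', ∑ a, (π s a).toReal * (M.P s a s').toReal :=
      Finset.sum_le_sum fun s' _ => Finset.sum_le_sum fun a _ => mul_le_of_le_one_right
        (mul_nonneg ENNReal.toReal_nonneg ENNReal.toReal_nonneg) (M.γ_le_one s a s')
    _ = 1 := by
      rw [Finset.sum_comm]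
      simp only [← Finset.mul_sum, sum_toReal_pmf, mul_one]

theorem MDP.resolventValue_eq_sum_backup [DecidableEq S] [Fintype A]
    (hU : IsUnit (1 - M.discMatrix π)) (g : ℝ → ℝ) (s : S) :
    M.resolventValue π g s =
      ∑ a, (π s a).toReal * M.backup g (M.resolventValue π g) s a := by
  have h_fixed : (1 - M.discMatrix π) *ᵥ M.resolventValue π g =
      fun s => ∑ a, (π s a).toReal * M.backup g 0 s a := by
    rw [resolventValue, mulVec_mulVec, mul_nonsing_inv _ ((isUnit_iff_isUnit_det _).1 hU),
      one_mulVec]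
  rw [sub_mulVec, one_mulVec, sub_eq_iff_eq_add] at h_fixed
  rw [congrFun h_fixed s]
  simp only [M.backup_eq_backup_zero_add g (M.resolventValue π g), mul_add, Pi.add_apply,
    Finset.sum_add_distrib, mulVec, dotProduct, discMatrix, of_apply, Finset.sum_mul,
    Finset.mul_sum]
  rw [Finset.sum_comm (γ := A)]
  simp only [mul_assoc]

variable [Fintype A] [MeasurableSpace S] [MeasurableSpace A] [MeasurableSingletonClass S]
  [MeasurableSingletonClass A]

theorem MDP.integrable_and_integral_stepLaw_backup
    (hg : ∀ s a s', Integrable g (M.rewardLaw s a s')) (b : S → PMF A) (v : S → ℝ) (x : S × A) :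
    Integrable (fun o => g o.1 + M.γ x.1 x.2 o.2.1 * v o.2.1) (M.stepLaw b x) ∧
      ∫ o, g o.1 + M.γ x.1 x.2 o.2.1 * v o.2.1 ∂M.stepLaw b x = M.backup g v x.1 x.2 := by
  have hP := M.isProbabilityMeasure_rewardLaw x.1 x.2
  have h : ∀ (s' : S) (_ : A), Integrable (fun r => g r + M.γ x.1 x.2 s' * v s')
      (M.rewardLaw x.1 x.2 s') := fun s' _ => (hg x.1 x.2 s').add (integrable_const _)
  refine ⟨M.integrable_stepLaw b h, (M.integral_stepLaw b h).trans ?_⟩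
  refine Finset.sum_congr rfl fun s' _ => ?_
  dsimp only
  rw [← Finset.sum_smul, ← Finset.mul_sum, sum_toReal_pmf, mul_one, smul_eq_mul,
    integral_add (hg x.1 x.2 s') (integrable_const _), integral_const, probReal_univ, one_smul]

variable {ν₀ : Measure (Obs S A)} [IsProbabilityMeasure ν₀]

theorem MDP.hasStateMoment_discountProd [DecidableEq S] (M : MDP S A) (π : S → PMF A)
    (ν₀ : Measure (Obs S A)) [IsProbabilityMeasure ν₀] (k : ℕ) :
    HasStateMoment (M.law π ν₀) π (k + 1) (M.discountProd (k + 1))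
      ((fun s' => ∑ x, ν₀.real {o | o.2 = x} * ((M.P x.1 x.2 s').toReal * M.γ x.1 x.2 s')) ᵥ*
        M.discMatrix π ^ k) := by
  induction k with
  | zero =>
    have h_zero : ∀ x, moment (M.law π ν₀) 0 (M.discountProd 0) x = ν₀.real {o | o.2 = x} :=
      fun x => (M.moment_zero_const π ν₀ 1 x).trans (mul_one _)
    simp only [pow_zero, vecMul_one, discountProd_succ, ← h_zero]
    exact (M.isHistoryFunction_discountProd 0).hasStateMoment_transition_mul M.γ
  | succ k ih =>
    rw [discountProd_succ, pow_succ, ← vecMul_vecMul]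
    exact ih.transition_mul (M.isHistoryFunction_discountProd (k + 1)) M.γ

theorem MDP.integrable_and_integral_discountProd_mul_reward
    (hg : ∀ s a s', Integrable g (M.rewardLaw s a s')) (k : ℕ) :
    Integrable (fun ω => M.discountProd k ω * g (rewardAt (k + 1) ω)) (M.law π ν₀) ∧
      ∫ ω, M.discountProd k ω * g (rewardAt (k + 1) ω) ∂M.law π ν₀ =
        ∑ x, moment (M.law π ν₀) k (M.discountProd k) x * M.backup g 0 x.1 x.2 := by
  have h_step := M.integrable_and_integral_stepLaw_backup hg π 0
  simp only [Pi.zero_apply, mul_zero, add_zero] at h_step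
  have h := M.integrable_and_integral_step_smul π ν₀ (M.isHistoryFunction_discountProd k)
    fun x => (h_step x).1
  simp only [fun x => (h_step x).2] at h
  exact h

theorem MDP.hasSum_integral_discountProd_mul_reward [DecidableEq S]
    (hU : IsUnit (1 - M.discMatrix π)) (hg : ∀ s a s', Integrable g (M.rewardLaw s a s')) :
    HasSum (fun k => ∫ ω, M.discountProd k ω * g (rewardAt (k + 1) ω) ∂M.law π ν₀)
      (∑ x, ν₀.real {o | o.2 = x} * M.backup g (M.resolventValue π g) x.1 x.2) := by
  let f : S → ℝ := fun s' =>
    ∑ x, ν₀.real {o | o.2 = x} * ((M.P x.1 x.2 s').toReal * M.γ x.1 x.2 s')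
  let r : S → ℝ := fun s => ∑ a, (π s a).toReal * M.backup g 0 s a
  have h_zero : ∫ ω, M.discountProd 0 ω * g (rewardAt (0 + 1) ω) ∂M.law π ν₀ =
      ∑ x, ν₀.real {o | o.2 = x} * M.backup g 0 x.1 x.2 := by
    rw [(M.integrable_and_integral_discountProd_mul_reward hg 0).2]
    exact Finset.sum_congr rfl fun x _ => congrArg (· * _) <|
      (M.moment_zero_const π ν₀ 1 x).trans (mul_one _)
  have h_succ : ∀ k, ∫ ω, M.discountProd (k + 1) ω * g (rewardAt (k + 1 + 1) ω) ∂M.law π ν₀ =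
      f ⬝ᵥ M.discMatrix π ^ k *ᵥ r := fun k => by
    rw [(M.integrable_and_integral_discountProd_mul_reward hg (k + 1)).2, dotProduct_mulVec,
      Fintype.sum_prod_type]
    simp only [M.hasStateMoment_discountProd π ν₀ k _ _, mul_assoc, ← Finset.mul_sum, dotProduct,
      f, r]
  have h_series : HasSum (fun k => f ⬝ᵥ M.discMatrix π ^ k *ᵥ r) (f ⬝ᵥ M.resolventValue π g) :=
    have h_pow := (M.isSubstochastic_discMatrix π).hasSum_pow hU
    hasSum_sum fun x _ => (hasSum_sum fun y _ =>
      (Pi.hasSum.1 (Pi.hasSum.1 h_pow x) y).mul_right (r y)).mul_left (f x)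
  have h_total : ∑ x, ν₀.real {o | o.2 = x} * M.backup g (M.resolventValue π g) x.1 x.2 =
      ∑ x, ν₀.real {o | o.2 = x} * M.backup g 0 x.1 x.2 + f ⬝ᵥ M.resolventValue π g := by
    simp only [M.backup_eq_backup_zero_add g (M.resolventValue π g), mul_add,
      Finset.sum_add_distrib, f, dotProduct, Finset.sum_mul, Finset.mul_sum]
    rw [Finset.sum_comm (s := (Finset.univ : Finset S))]
    simp only [mul_assoc]
  rw [h_total, ← h_zero]
  exact HasSum.zero_add (by simpa only [h_succ] using h_series)

-- The case `g = |·|` makes the series of rewards absolutely convergent in mean, so that it may be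
-- integrated term by term.
theorem MDP.integral_discountedReturn [DecidableEq S] (hU : IsUnit (1 - M.discMatrix π)) :
    ∫ ω, M.discountedReturn ω ∂M.law π ν₀ =
      ∑ x, ν₀.real {o | o.2 = x} * M.backup id (M.resolventValue π id) x.1 x.2 := by
  have h_norm : ∀ k (ω : Path S A), ‖M.discountProd k ω * rewardAt (k + 1) ω‖ =
      M.discountProd k ω * |rewardAt (k + 1) ω| := fun k ω => by
    rw [norm_mul, Real.norm_of_nonneg (M.discountProd_nonneg k ω), Real.norm_eq_abs]
  have h_summable : Summable fun k =>
      ∫ ω, ‖M.discountProd k ω * rewardAt (k + 1) ω‖ ∂M.law π ν₀ := by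
    simp only [h_norm]
    exact (M.hasSum_integral_discountProd_mul_reward hU
      fun s a s' => (M.integrable_reward s a s').abs).summable
  exact (hasSum_integral_of_summable_integral_norm
    (fun k => (M.integrable_and_integral_discountProd_mul_reward M.integrable_reward k).1)
    h_summable).unique (M.hasSum_integral_discountProd_mul_reward hU M.integrable_reward)

theorem MDP.actionValue_eq_backup_resolventValue [DecidableEq S]
    (hU : IsUnit (1 - M.discMatrix π)) (s : S) (a : A) :
    M.actionValue π s a = M.backup id (M.resolventValue π id) s a := by
  classical
  rw [actionValue, pathLawFrom, M.integral_discountedReturn hU]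
  simp [measureReal_def, Set.indicator_apply, Fintype.sum_prod_type, Prod.ext_iff, ite_and,
    apply_ite ENNReal.toReal]

theorem MDP.value_eq_resolventValue [DecidableEq S] (hU : IsUnit (1 - M.discMatrix π)) :
    M.value π = M.resolventValue π id := by
  ext s
  rw [M.resolventValue_eq_sum_backup hU, value, pathLaw, M.integral_discountedReturn hU,
    Fintype.sum_prod_type]
  simp only [startLaw_real_snd_eq]
  simp [PMF.pure_apply, apply_ite ENNReal.toReal]

theorem MDP.actionValue_eq_backup_value [DecidableEq S] (hU : IsUnit (1 - M.discMatrix π)) (s : S)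
    (a : A) : M.actionValue π s a = M.backup id (M.value π) s a := by
  rw [M.value_eq_resolventValue hU, M.actionValue_eq_backup_resolventValue hU]

end Values

section Gradients

variable {B : Type*}

theorem toReal_mul_ratio {p q : PMF B} {b : B} (hpq : q b = 0 → p b = 0) :
    (q b).toReal * ((p b).toReal / (q b).toReal) = (p b).toReal :=
  mul_div_cancel_of_imp' fun h => by
    rw [hpq (((ENNReal.toReal_eq_zero_iff _).1 h).resolve_right (q.apply_ne_top b)),
      ENNReal.toReal_zero]

variable {E : Type*} [NormedAddCommGroup E] [InnerProductSpace ℝ E] [CompleteSpace E]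
  {p : E → PMF B} {θ : E}

-- Where `p θ b = 0`, the map `ϑ ↦ p ϑ b` has a minimum at `θ`, so both sides vanish.
theorem smul_gradient_log_pmf {b : B} (hp : DifferentiableAt ℝ (fun ϑ => (p ϑ b).toReal) θ) :
    (p θ b).toReal • gradient (fun ϑ => Real.log (p ϑ b).toReal) θ =
      gradient (fun ϑ => (p ϑ b).toReal) θ := by
  obtain h_zero | h_ne := eq_or_ne (p θ b).toReal 0
  · have h_min : IsLocalMin (fun ϑ => (p ϑ b).toReal) θ :=
      .of_forall fun _ => h_zero.trans_le ENNReal.toReal_nonneg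
    rw [h_zero, zero_smul, gradient, h_min.fderiv_eq_zero, map_zero]
  · rw [gradient, gradient, fderiv.log hp h_ne, map_smul, smul_inv_smul₀ h_ne]

theorem smul_ratio_smul_gradient_log_pmf {b : B} {q : PMF B}
    (hp : DifferentiableAt ℝ (fun ϑ => (p ϑ b).toReal) θ) (hpq : q b = 0 → p θ b = 0) :
    (q b).toReal • ((p θ b).toReal / (q b).toReal) •
        gradient (fun ϑ => Real.log (p ϑ b).toReal) θ =
      gradient (fun ϑ => (p ϑ b).toReal) θ := by
  rw [smul_smul, toReal_mul_ratio hpq, smul_gradient_log_pmf hp]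

theorem sum_gradient_pmf [Fintype B]
    (hp : ∀ b, DifferentiableAt ℝ (fun ϑ => (p ϑ b).toReal) θ) :
    ∑ b, gradient (fun ϑ => (p ϑ b).toReal) θ = 0 := by
  simp only [gradient]
  rw [← map_sum, ← fderiv_fun_sum fun b _ => hp b]
  simp only [sum_toReal_pmf, fderiv_fun_const, Pi.zero_apply, map_zero]

theorem sum_sub_smul_gradient_pmf [Fintype B]
    (hp : ∀ b, DifferentiableAt ℝ (fun ϑ => (p ϑ b).toReal) θ) (q : B → ℝ) (c : ℝ) :
    ∑ b, (q b - c) • gradient (fun ϑ => (p ϑ b).toReal) θ =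
      ∑ b, q b • gradient (fun ϑ => (p ϑ b).toReal) θ := by
  simp only [sub_smul, Finset.sum_sub_distrib]
  rw [← Finset.smul_sum, sum_gradient_pmf hp, smul_zero, sub_zero]

end Gradients

section Emphasis

open Matrix

variable {S A : Type*}

theorem MDP.isHistoryFunction_followOn (M : MDP S A) (π μ : S → PMF A) (i : S → ℝ) (t : ℕ) :
    IsHistoryFunction t (M.followOn π μ i t) := by
  induction t with
  | zero => exact fun _ _ _ => rfl
  | succ t ih =>
    exact ((((isHistoryFunction_transition t M.γ).mul
      (isHistoryFunction_comp_snd t.le_succ fun x => (π x.1 x.2).toReal / (μ x.1 x.2).toReal)).mul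
        (ih.mono t.le_succ)).add (isHistoryFunction_comp_snd le_rfl fun x => i x.1))

theorem MDP.isHistoryFunction_emphasis (M : MDP S A) (π μ : S → PMF A) (i : S → ℝ) (lam : ℝ)
    (t : ℕ) : IsHistoryFunction t (M.emphasis π μ i lam t) :=
  (isHistoryFunction_comp_snd le_rfl fun x => (1 - lam) * i x.1).add <|
    (isHistoryFunction_comp_snd le_rfl fun _ => lam).mul (M.isHistoryFunction_followOn π μ i t)

theorem MDP.weightedMatrix_mul_ratio [Fintype A] (M : MDP S A) {π μ : S → PMF A}
    (hcov : ∀ s a, μ s a = 0 → π s a = 0) :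
    M.weightedMatrix μ (fun s a s' => M.γ s a s' * ((π s a).toReal / (μ s a).toReal)) =
      M.discMatrix π := by
  ext s s'
  refine Finset.sum_congr rfl fun a _ => ?_
  rw [← toReal_mul_ratio (hcov s a)]
  ring

variable [Fintype S] [Fintype A]

section Weighting

variable [DecidableEq S] (M : MDP S A) {π : S → PMF A} (d i : S → ℝ)

theorem MDP.emphaticWeightingTrace_eq (hU : IsUnit (1 - M.discMatrix π)) (lam : ℝ) :
    M.emphaticWeightingTrace π d i lam =
      (1 - lam) • (d * i) + lam • M.emphaticWeighting π d i := by
  have h_split : 1 - (1 - lam) • M.discMatrix π =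
      (1 - lam) • (1 - M.discMatrix π) + lam • (1 : Matrix S S ℝ) := by
    module
  rw [emphaticWeightingTrace, h_split, Matrix.mul_add, Matrix.mul_smul, Matrix.mul_smul,
    nonsing_inv_mul _ ((isUnit_iff_isUnit_det _).1 hU), Matrix.mul_one, vecMul_add, vecMul_smul,
    vecMul_smul, vecMul_one]
  rfl

theorem MDP.emphaticWeightingTrace_one :
    M.emphaticWeightingTrace π d i 1 = M.emphaticWeighting π d i := by
  rw [emphaticWeightingTrace, sub_self, zero_smul, sub_zero, Matrix.mul_one, emphaticWeighting]

end Weighting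

variable [MeasurableSpace S] [MeasurableSpace A] [MeasurableSingletonClass S]
  [MeasurableSingletonClass A]

/-- The vector `s ↦ E[F_t 1{S_t = s}]` of state moments of the follow-on trace, by its recursion. -/
def MDP.followOnMean (M : MDP S A) (π μ : S → PMF A) (ν : PMF S) (i : S → ℝ) : ℕ → S → ℝ
  | 0 => 0
  | t + 1 => M.followOnMean π μ ν i t ᵥ* M.discMatrix π + i * M.stateLaw μ ν (t + 1)

/-- The vector `s ↦ E[M_t 1{S_t = s}]` of state moments of the emphasis. -/
def MDP.emphasisMean (M : MDP S A) (π μ : S → PMF A) (ν : PMF S) (i : S → ℝ) (lam : ℝ)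
    (t : ℕ) : S → ℝ :=
  (1 - lam) • (i * M.stateLaw μ ν t) + lam • M.followOnMean π μ ν i t

section StateMoments

variable (M : MDP S A) {π μ : S → PMF A} (hcov : ∀ s a, μ s a = 0 → π s a = 0) (ν : PMF S)
  (i : S → ℝ)
include hcov

theorem MDP.hasStateMoment_followOn (t : ℕ) :
    HasStateMoment (M.pathLaw μ ν) μ t (M.followOn π μ i t) (M.followOnMean π μ ν i t) := by
  induction t with
  | zero => exact fun s a => by simp [moment, followOn, followOnMean]
  | succ t ih =>
    have h_hist := M.isHistoryFunction_followOn π μ i t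
    let c : S → A → S → ℝ := fun s a s' => M.γ s a s' * ((π s a).toReal / (μ s a).toReal)
    have h_trans := ih.transition_mul h_hist c
    rw [M.weightedMatrix_mul_ratio hcov] at h_trans
    have h_add := h_trans.add ((M.hasStateMoment_one_pathLaw μ ν (t + 1)).state_mul i)
      (((isHistoryFunction_transition t c).mul (h_hist.mono t.le_succ)).integrable _)
      ((isHistoryFunction_comp_snd le_rfl fun x => i x.1 * 1).integrable _)
    simp only [mul_one] at h_add
    exact h_add

theorem MDP.hasStateMoment_emphasis (lam : ℝ) (t : ℕ) :
    HasStateMoment (M.pathLaw μ ν) μ t (M.emphasis π μ i lam t)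
      (M.emphasisMean π μ ν i lam t) := by
  have h_hist := M.isHistoryFunction_followOn π μ i t
  have h_add := ((M.hasStateMoment_one_pathLaw μ ν t).state_mul ((1 - lam) • i)).add
    ((M.hasStateMoment_followOn hcov ν i t).state_mul fun _ => lam)
    ((isHistoryFunction_comp_snd le_rfl fun x => (1 - lam) * i x.1 * 1).integrable _)
    (((isHistoryFunction_comp_snd le_rfl fun _ => lam).mul h_hist).integrable _)
  simp only [mul_one, smul_mul_assoc] at h_add
  exact h_add

end StateMoments

section Limit

variable [DecidableEq S] {M : MDP S A} {π μ : S → PMF A} {ν : PMF S} {d : S → ℝ}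

theorem MDP.tendsto_followOnMean (hU : IsUnit (1 - M.discMatrix π))
    (hd : M.IsLimitingDistribution μ ν d) (i : S → ℝ) :
    Tendsto (M.followOnMean π μ ν i) atTop (𝓝 (M.emphaticWeighting π d i)) := by
  have h_source : Tendsto (fun t => i * M.stateLaw μ ν (t + 1)) atTop (𝓝 fun s => d s * i s) :=
    tendsto_pi_nhds.2 fun s =>
      mul_comm (d s) (i s) ▸ ((tendsto_add_atTop_iff_nat 1).2 (hd s)).const_mul (i s)
  exact (M.isSubstochastic_discMatrix π).tendsto_of_affine_recursion hU (fun _ => rfl) h_source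

theorem MDP.tendsto_emphasisMean (hU : IsUnit (1 - M.discMatrix π))
    (hd : M.IsLimitingDistribution μ ν d) (i : S → ℝ) (lam : ℝ) :
    Tendsto (M.emphasisMean π μ ν i lam) atTop (𝓝 (M.emphaticWeightingTrace π d i lam)) := by
  have h_stateLaw : Tendsto (M.stateLaw μ ν) atTop (𝓝 d) := tendsto_pi_nhds.2 hd
  rw [M.emphaticWeightingTrace_eq d i hU, mul_comm d i]
  exact ((h_stateLaw.const_mul i).const_smul (1 - lam)).add
    ((M.tendsto_followOnMean hU hd i).const_smul lam)

end Limit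

section ActorUpdate

variable [DecidableEq S] {M : MDP S A}

theorem MDP.integrable_and_integral_stepLaw_tdError {π : S → PMF A}
    (hU : IsUnit (1 - M.discMatrix π)) (b : S → PMF A) (x : S × A) :
    Integrable (fun o => o.1 + M.γ x.1 x.2 o.2.1 * M.value π o.2.1 - M.value π x.1)
        (M.stepLaw b x) ∧
      ∫ o, o.1 + M.γ x.1 x.2 o.2.1 * M.value π o.2.1 - M.value π x.1 ∂M.stepLaw b x =
        M.actionValue π x.1 x.2 - M.value π x.1 := by
  obtain ⟨h_int, h_mean⟩ :=
    M.integrable_and_integral_stepLaw_backup (g := id) M.integrable_reward b (M.value π) x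
  refine ⟨h_int.sub (integrable_const _), ?_⟩
  rw [M.actionValue_eq_backup_value hU, ← h_mean]
  refine (integral_sub h_int (integrable_const _)).trans ?_
  rw [integral_const, probReal_univ, one_smul]

theorem MDP.integrable_and_integral_actorUpdate {d : ℕ}
    {π : EuclideanSpace ℝ (Fin d) → S → PMF A} {θ : EuclideanSpace ℝ (Fin d)}
    (hπ : ∀ s a, DifferentiableAt ℝ (fun ϑ => (π ϑ s a).toReal) θ)
    (hU : IsUnit (1 - M.discMatrix (π θ))) {μ : S → PMF A}
    (hcov : ∀ s a, μ s a = 0 → π θ s a = 0) (ν : PMF S) (i : S → ℝ) (lam : ℝ) (t : ℕ) :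
    Integrable (M.actorUpdate π θ μ i lam t) (M.pathLaw μ ν) ∧
      ∫ ω, M.actorUpdate π θ μ i lam t ω ∂M.pathLaw μ ν =
        ∑ s, M.emphasisMean (π θ) μ ν i lam t s •
          ∑ a, M.actionValue (π θ) s a • gradient (fun ϑ => (π ϑ s a).toReal) θ := by
  let v := M.value (π θ)
  let G : S × A → EuclideanSpace ℝ (Fin d) := fun x =>
    ((π θ x.1 x.2).toReal / (μ x.1 x.2).toReal) •
      gradient (fun ϑ => Real.log (π ϑ x.1 x.2).toReal) θ
  have hG : ∀ s a, (μ s a).toReal • G (s, a) = gradient (fun ϑ => (π ϑ s a).toReal) θ :=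
    fun s a => smul_ratio_smul_gradient_log_pmf (p := fun ϑ => π ϑ s) (hπ s a) (hcov s a)
  have h_update : M.actorUpdate π θ μ i lam t = fun ω => M.emphasis (π θ) μ i lam t ω •
      (rewardAt (t + 1) ω + M.discountAfter t ω * v (stateAt (t + 1) ω) - v (stateAt t ω)) •
        G (ω t).2 := funext fun ω => by
    simp only [actorUpdate, tdError, smul_smul, G, v]
    congr 1
    rw [ratioAt]
    simp only [stateAt, actionAt]
    ring
  have h_td := M.integrable_and_integral_stepLaw_tdError hU μ
  have h_step := M.integrable_and_integral_step_smul μ (startLaw μ ν)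
    (M.isHistoryFunction_emphasis (π θ) μ i lam t) fun x => (h_td x).1.smul_const (G x)
  rw [h_update]
  refine ⟨h_step.1, h_step.2.trans ?_⟩
  rw [Fintype.sum_prod_type]
  refine Finset.sum_congr rfl fun s _ => ?_
  rw [← sum_sub_smul_gradient_pmf (p := fun ϑ => π ϑ s) (hπ s) _ (v s), Finset.smul_sum]
  refine Finset.sum_congr rfl fun a _ => ?_
  have h_moment : moment (M.law μ (startLaw μ ν)) t (M.emphasis (π θ) μ i lam t) (s, a) = _ :=
    M.hasStateMoment_emphasis hcov ν i lam t s a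
  rw [integral_smul_const, (h_td (s, a)).2, h_moment, ← hG, mul_smul, smul_comm (μ s a).toReal]

end ActorUpdate

end Emphasis

end OffPolicy

end

theorem proposition1_general {S A : Type*} [Fintype S] [DecidableEq S] [MeasurableSpace S]
    [MeasurableSingletonClass S] [Fintype A] [MeasurableSpace A] [MeasurableSingletonClass A]
    (M : OffPolicy.MDP S A) {d : ℕ} (π : EuclideanSpace ℝ (Fin d) → S → PMF A)
    (θ : EuclideanSpace ℝ (Fin d)) (hπ : ∀ s a, DifferentiableAt ℝ (fun ϑ => (π ϑ s a).toReal) θ)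
    (μ : S → PMF A) (hU : IsUnit (1 - M.discMatrix (π θ)))
    (hcov : ∀ s a, μ s a = 0 → π θ s a = 0) (ν : PMF S) (dμ : S → ℝ)
    (hdμ : M.IsLimitingDistribution μ ν dμ) (i : S → ℝ) (lam : ℝ) :
    (∀ t, Integrable (M.actorUpdate π θ μ i lam t) (M.pathLaw μ ν)) ∧
      Tendsto (fun t => ∫ ω, M.actorUpdate π θ μ i lam t ω ∂(M.pathLaw μ ν)) atTop
        (𝓝 (∑ s, M.emphaticWeightingTrace (π θ) dμ i lam s •
          ∑ a, M.actionValue (π θ) s a • gradient (fun ϑ => (π ϑ s a).toReal) θ)) := by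
  have h_update := M.integrable_and_integral_actorUpdate hπ hU hcov ν i lam
  refine ⟨fun t => (h_update t).1, ?_⟩
  simp only [fun t => (h_update t).2]
  exact tendsto_finsetSum _ fun s _ =>
    (tendsto_pi_nhds.1 (M.tendsto_emphasisMean hU hdμ i lam) s).smul_const _

theorem proposition1 {S A : Type*} [Fintype S] [DecidableEq S] [MeasurableSpace S]
    [MeasurableSingletonClass S] [Fintype A] [MeasurableSpace A] [MeasurableSingletonClass A]
    (M : OffPolicy.MDP S A) {d : ℕ}
    (π : EuclideanSpace ℝ (Fin d) → S → PMF A)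
    (hπ : ∀ s a, Differentiable ℝ (fun ϑ => (π ϑ s a).toReal))
    (θ : EuclideanSpace ℝ (Fin d)) (μ : S → PMF A)
    (hYu : M.YuConditions (π θ) μ)
    (ν : PMF S) (dμ : S → ℝ) (hdμ : M.IsLimitingDistribution μ ν dμ)
    (i : S → ℝ) (hi : ∀ s, 0 ≤ i s) :
    (∀ lam ∈ Set.Icc (0 : ℝ) 1,
      (∀ t, Integrable (M.actorUpdate π θ μ i lam t) (M.pathLaw μ ν)) ∧
      Tendsto (fun t => ∫ ω, M.actorUpdate π θ μ i lam t ω ∂(M.pathLaw μ ν)) atTop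
        (𝓝 (∑ s, M.emphaticWeightingTrace (π θ) dμ i lam s •
          ∑ a, M.actionValue (π θ) s a • gradient (fun ϑ => (π ϑ s a).toReal) θ))) ∧
    Tendsto (fun t => ∫ ω, M.actorUpdate π θ μ i 1 t ω ∂(M.pathLaw μ ν)) atTop
      (𝓝 (∑ s, M.emphaticWeighting (π θ) dμ i s •
        ∑ a, M.actionValue (π θ) s a • gradient (fun ϑ => (π ϑ s a).toReal) θ)) := by
  have h := proposition1_general M π θ (fun s a => hπ s a θ) μ hYu.isUnit hYu.coverage ν dμ hdμ i
  exact ⟨fun lam _ => h lam, M.emphaticWeightingTrace_one dμ i ▸ (h 1).2⟩
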